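/- Let $\sigma^2>0$, $a$, $b$, $c$ be fixed real numbers, and let $\epsilon=\{\epsilon_{i,j}\}_{i,j\in\mathbb Z}$ be a collection of pairwise uncorrelated real random variables on a probability space, with zero mean and common variance $\sigma^2$. Consider the equation \[ X_{i,j}=aX_{i-1,j}+bX_{i,j-1}+cX_{i-1,j-1}+\epsilon_{i,j}\quad\text{almost surely, for all } i,j\in\mathbb Z. \tag{1} \] A stationary solution of (1) is a field $X=\{X_{i,j}\}_{i,j\in\mathbb Z}$ of square-integrable real random variables satisfying (1) that is wide-sense stationary, i.e. $\mathbb E X_{i,j}$ does not depend on $(i,j)$ and $\operatorname{cov}(X_{i+h_1,j+h_2},X_{i'+h_1,j'+h_2})=\operatorname{cov}(X_{i,j},X_{i',j'})$ for all integers $i,j,i',j',h_1,h_2$. Put \[ D=(1-a-b-c)(1-a+b+c)(1+a-b+c)(1+a+b-c). \] Suppose that $D>0$, and for $k,l\in\mathbb Z$ let \[ \psi_{k,l}=\int_{-1/2}^{1/2}\int_{-1/2}^{1/2}\frac{\exp(-2\pi\mathrm i(k\nu_1+l\nu_2))}{1-ae^{2\pi\mathrm i\nu_1}-be^{2\pi\mathrm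 i\nu_2}-ce^{2\pi\mathrm i(\nu_1+\nu_2)}}\,d\nu_2\,d\nu_1 . \] Then the numbers $\psi_{k,l}$ are real and $\sum_{k,l\in\mathbb Z}|\psi_{k,l}|<\infty$. For all $i,j\in\mathbb Z$ the double series \[ X_{i,j}=\sum_{k=-\infty}^{\infty}\sum_{l=-\infty}^{\infty}\psi_{k,l}\,\epsilon_{i-k,j-l} \tag{2} \] converges absolutely almost surely, and it converges unconditionally (along the finite subsets of $\mathbb Z^2$) in mean square to the same limit. The field $X$ defined by (2) is a stationary solution of (1), and it is the only one: every stationary solution $\widetilde X$ of (1) satisfies $\widetilde X_{i,j}=X_{i,j}$ almost surely for all $i,j\in\mathbb Z$. -/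

import Mathlib

open MeasureTheory ProbabilityTheory Filter Topology

noncomputable section

namespace PlanarAR

/-- The quantity `D` attached to the coefficients. -/
def discr (a b c : ℝ) : ℝ :=
  (1 - a - b - c) * (1 - a + b + c) * (1 + a - b + c) * (1 + a + b - c)

/-- The Fourier coefficients of the reciprocal of the symbol of the equation, as the complex numbers
given by the double integral over `[-1/2, 1/2] × [-1/2, 1/2]`. -/
def psiC (a b c : ℝ) (k l : ℤ) : ℂ :=
  ∫ ν₁ in (-1 / 2 : ℝ)..(1 / 2 : ℝ), ∫ ν₂ in (-1 / 2 : ℝ)..(1 / 2 : ℝ),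
    Complex.exp (-2 * Real.pi * Complex.I * (k * ν₁ + l * ν₂)) /
      (1 - a * Complex.exp (2 * Real.pi * Complex.I * ν₁)
         - b * Complex.exp (2 * Real.pi * Complex.I * ν₂)
         - c * Complex.exp (2 * Real.pi * Complex.I * (ν₁ + ν₂)))

/-- The weights as real numbers (that the imaginary part of `psiC` vanishes is part of the
conclusion of the theorem). -/
def psi (a b c : ℝ) (k l : ℤ) : ℝ := (psiC a b c k l).re

variable {Ω : Type*} [MeasurableSpace Ω]

/-- A family of square-integrable, pairwise uncorrelated random variables with zero mean and
common variance `σsq`. -/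
structure IsWhiteNoise (P : Measure Ω) (σsq : ℝ) (ε : ℤ × ℤ → Ω → ℝ) : Prop where
  memLp : ∀ p, MemLp (ε p) 2 P
  mean_zero : ∀ p, ∫ ω, ε p ω ∂P = 0
  variance_eq : ∀ p, variance (ε p) P = σsq
  uncorrelated : ∀ p q, p ≠ q → covariance (ε p) (ε q) P = 0

/-- Wide-sense stationarity of a random field on the planar integer lattice. -/
structure IsWideSenseStationary (P : Measure Ω) (X : ℤ × ℤ → Ω → ℝ) : Prop where
  memLp : ∀ p, MemLp (X p) 2 P
  mean_eq : ∀ p q, ∫ ω, X p ω ∂P = ∫ ω, X q ω ∂P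
  covariance_shift : ∀ p q h, covariance (X (p + h)) (X (q + h)) P = covariance (X p) (X q) P

/-- The field `X` satisfies the first-order planar autoregressive equation with noise `ε`,
almost surely at every lattice point. -/
def SatisfiesEquation (P : Measure Ω) (a b c : ℝ) (ε X : ℤ × ℤ → Ω → ℝ) : Prop :=
  ∀ i j : ℤ, ∀ᵐ ω ∂P,
    X (i, j) ω = a * X (i - 1, j) ω + b * X (i, j - 1) ω + c * X (i - 1, j - 1) ω + ε (i, j) ω

/-- A wide-sense stationary solution of the equation with coefficients `a b c` and noise `ε`. -/
def IsStationarySolution (P : Measure Ω) (a b c : ℝ) (ε X : ℤ × ℤ → Ω → ℝ) : Prop :=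
  IsWideSenseStationary P X ∧ SatisfiesEquation P a b c ε X

/-- The term of index `(k, l)` of the double series at the lattice point `(i, j)`. -/
def seriesTerm (a b c : ℝ) (ε : ℤ × ℤ → Ω → ℝ) (i j : ℤ) (kl : ℤ × ℤ) (ω : Ω) : ℝ :=
  psi a b c kl.1 kl.2 * ε (i - kl.1, j - kl.2) ω

/-- The field defined pointwise as the sum of the (unordered) double series
(with value `0` at those `ω` where the series does not converge). -/
def seriesField (a b c : ℝ) (ε : ℤ × ℤ → Ω → ℝ) (p : ℤ × ℤ) (ω : Ω) : ℝ :=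
  ∑' kl : ℤ × ℤ, seriesTerm a b c ε p.1 p.2 kl ω

end PlanarAR

end

/-! With `z`, `w` on the unit circle, the symbol is `A - B w`, where `A = 1 - a z` and `B = b + c
z`. The difference `‖A‖² - ‖B‖²` interpolates between two numbers with product `D`. If `D > 0` they
share a sign, so one of `A`, `B` dominates the other uniformly in `z` (`exists_separation`). The
Fourier coefficients of `1 / (A - B w)` in `w` therefore decay geometrically, which bounds `psiC` in
`l` uniformly in `k`. Exchanging the variables gives decay in `k`, and the two bounds together give
summability (`summable_norm_psiC`).

Since `ψ` is the convolution inverse of the equation's coefficients (`psi_recurrence`), convolution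
with `ψ` is a two-sided inverse of the autoregressive operator on bounded families in a Banach space
(`arOp_conv`, `conv_arOp`). In `L²` the noise is bounded, which gives existence, and every
stationary field is bounded, which gives uniqueness. -/

noncomputable section

namespace PlanarAR

/-! ### Fourier coefficients of a geometric kernel. -/

/-- The character `ν ↦ exp (2π i ν)`. -/
def expChar (ν : ℝ) : ℂ := Complex.exp (2 * Real.pi * Complex.I * ν)

lemma continuous_expChar : Continuous expChar := by unfold expChar; fun_prop

lemma norm_expChar (ν : ℝ) : ‖expChar ν‖ = 1 := by
  have : (2 * Real.pi * Complex.I * ν : ℂ) = ((2 * Real.pi * ν : ℝ) : ℂ) * Complex.I := by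
    push_cast; ring
  rw [expChar, this, Complex.norm_exp_ofReal_mul_I]

lemma expChar_ne_zero (ν : ℝ) : expChar ν ≠ 0 := Complex.exp_ne_zero _

lemma exp_eq_expChar_zpow (k : ℤ) (ν : ℝ) :
    Complex.exp (2 * Real.pi * Complex.I * (k * ν)) = expChar ν ^ k := by
  rw [expChar, ← Complex.exp_int_mul]; congr 1; ring

lemma integral_expChar_zpow (k : ℤ) :
    ∫ ν in (-1 / 2 : ℝ)..(1 / 2 : ℝ), expChar ν ^ k = if k = 0 then 1 else 0 := by
  split_ifs with hk
  · subst hk; norm_num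
  · have hc : (2 * Real.pi * Complex.I * k : ℂ) ≠ 0 := by
      simp [hk, Real.pi_ne_zero, Complex.I_ne_zero]
    have : ∀ ν : ℝ, expChar ν ^ k = Complex.exp (2 * Real.pi * Complex.I * k * ν) := fun ν => by
      rw [← exp_eq_expChar_zpow]; congr 1; ring
    simp_rw [this]
    rw [integral_exp_mul_complex hc]
    have e : (2 * Real.pi * Complex.I * k * ((1 / 2 : ℝ) : ℂ) : ℂ)
        = 2 * Real.pi * Complex.I * k * ((-1 / 2 : ℝ) : ℂ) + k * (2 * Real.pi * Complex.I) := by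
      push_cast; ring
    rw [e, Complex.exp_periodic.int_mul k]
    simp

/-- The Fourier coefficients of `w ↦ (A - B w)⁻¹` on the unit circle. -/
def geomCoeff (A B : ℂ) (l : ℤ) : ℂ :=
  ∫ ν in (-1 / 2 : ℝ)..(1 / 2 : ℝ), expChar ν ^ (-l) / (A - B * expChar ν)

lemma continuous_expChar_zpow (k : ℤ) : Continuous fun ν => expChar ν ^ k :=
  continuous_expChar.zpow₀ k fun ν => Or.inl (expChar_ne_zero ν)

/-- Integrate `w ^ (-l) * (A - B w) / (A - B w) = w ^ (-l)`. -/
lemma geomCoeff_recurrence {A B : ℂ} (h : ∀ ν, A - B * expChar ν ≠ 0) (l : ℤ) :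
    A * geomCoeff A B l - B * geomCoeff A B (l - 1) = if l = 0 then 1 else 0 := by
  have hc : ∀ m : ℤ, Continuous fun ν => expChar ν ^ m / (A - B * expChar ν) := fun m =>
    (continuous_expChar_zpow m).div (continuous_const.sub (continuous_const.mul continuous_expChar)) h
  rw [geomCoeff, geomCoeff, ← intervalIntegral.integral_const_mul,
    ← intervalIntegral.integral_const_mul, ← intervalIntegral.integral_sub
      (((hc _).const_mul _).intervalIntegrable _ _) (((hc _).const_mul _).intervalIntegrable _ _)]
  have := integral_expChar_zpow (-l)
  simp only [neg_eq_zero] at this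
  rw [← this]
  congr 1
  ext ν
  have e : -(l - 1) = -l + 1 := by ring
  rw [e, zpow_add_one₀ (expChar_ne_zero ν)]
  have := h ν
  field_simp

lemma norm_geomCoeff_le {A B : ℂ} {m : ℝ} (hm : 0 < m) (h : ∀ ν, m ≤ ‖A - B * expChar ν‖)
    (l : ℤ) : ‖geomCoeff A B l‖ ≤ m⁻¹ := by
  have := intervalIntegral.norm_integral_le_of_norm_le_const (a := (-1 / 2 : ℝ)) (b := 1 / 2)
    (C := m⁻¹) (f := fun ν => expChar ν ^ (-l) / (A - B * expChar ν)) (fun ν _ => by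
      rw [norm_div, norm_zpow, norm_expChar, one_zpow, one_div]
      exact inv_anti₀ hm (h ν))
  refine this.trans_eq ?_
  norm_num

lemma le_pow_natAbs_of_le_mul {u : ℤ → ℝ} {r M : ℝ} (hr : 0 ≤ r) (hM : ∀ l, u l ≤ M)
    (h : ∀ l, l ≠ 0 → u l ≤ r * u (l - 1)) (l : ℤ) : u l ≤ M * r ^ l.natAbs := by
  have hpos : ∀ n : ℕ, u n ≤ M * r ^ n := by
    intro n
    induction n with
    | zero => simpa using hM 0
    | succ n ih =>
      have h1 := h ((n + 1 : ℕ) : ℤ) (by omega)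
      rw [show (((n + 1 : ℕ) : ℤ) - 1) = n by push_cast; ring] at h1
      calc _ ≤ r * u n := h1
        _ ≤ r * (M * r ^ n) := by gcongr
        _ = _ := by ring
  -- For `l < 0` the descent never meets the exceptional index `0`, so every power of `r` is
  -- available.
  have hneg : ∀ (n : ℕ) (l : ℤ), l < 0 → u l ≤ M * r ^ n := by
    intro n
    induction n with
    | zero => intro l _; simpa using hM l
    | succ n ih =>
      intro l hl
      calc _ ≤ r * u (l - 1) := h l hl.ne
        _ ≤ r * (M * r ^ n) := by gcongr; exact ih _ (by omega)
        _ = _ := by ring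
  rcases lt_or_ge l 0 with hl | hl
  · exact hneg _ l hl
  · lift l to ℕ using hl
    simpa using hpos l

lemma norm_geomCoeff_le_pow {A B : ℂ} {r m : ℝ} (hr : 0 < r) (hr1 : r < 1) (hm : 0 < m)
    (h : ∀ ν, m ≤ ‖A - B * expChar ν‖) (hAB : ‖B‖ ≤ r * ‖A‖ ∨ ‖A‖ ≤ r * ‖B‖) (l : ℤ) :
    ‖geomCoeff A B l‖ ≤ m⁻¹ * r⁻¹ * r ^ l.natAbs := by
  have hne : ∀ ν, A - B * expChar ν ≠ 0 := fun ν => norm_pos_iff.1 (hm.trans_le (h ν))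
  have hM := norm_geomCoeff_le hm h
  have hrec : ∀ l : ℤ, l ≠ 0 → ‖A‖ * ‖geomCoeff A B l‖ = ‖B‖ * ‖geomCoeff A B (l - 1)‖ := by
    intro l hl
    have := geomCoeff_recurrence hne l
    rw [if_neg hl, sub_eq_zero] at this
    rw [← norm_mul, ← norm_mul, this]
  have hmi : 0 ≤ m⁻¹ := by positivity
  have hri : 1 ≤ r⁻¹ := (one_le_inv₀ hr).2 hr1.le
  have hA0 : 0 < ‖A‖ ∨ 0 < ‖B‖ := by
    by_contra! hcon
    obtain ⟨h1, h2⟩ := hcon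
    rw [norm_le_zero_iff] at h1 h2
    exact hne 0 (by simp [h1, h2])
  rcases hAB with hAB | hAB
  · have hA : 0 < ‖A‖ := by
      rcases hA0 with h | h
      · exact h
      · by_contra hcon
        have : ‖A‖ = 0 := le_antisymm (not_lt.1 hcon) (norm_nonneg _)
        rw [this] at hAB; linarith
    refine (le_pow_natAbs_of_le_mul (u := fun l => ‖geomCoeff A B l‖) hr.le hM ?_ l).trans ?_
    · intro l hl
      refine le_of_mul_le_mul_left ?_ hA
      rw [hrec l hl]
      calc _ ≤ (r * ‖A‖) * ‖geomCoeff A B (l - 1)‖ := by gcongr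
        _ = _ := by ring
    · gcongr
      exact le_mul_of_one_le_right hmi hri
  · have hB : 0 < ‖B‖ := by
      rcases hA0 with h | h
      · by_contra hcon
        have : ‖B‖ = 0 := le_antisymm (not_lt.1 hcon) (norm_nonneg _)
        rw [this] at hAB; linarith
      · exact h
    -- When `B` dominates, the recurrence contracts upwards; the reflection `l ↦ -1 - l` reverses
    -- it, and the factor `r⁻¹` absorbs the shift by one.
    have key := le_pow_natAbs_of_le_mul (u := fun l => ‖geomCoeff A B (-1 - l)‖) hr.le
      (fun _ => hM _) (fun l hl => by
        refine le_of_mul_le_mul_left ?_ hB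
        have h1 := hrec (-l) (by omega)
        rw [show -l - 1 = -1 - l by ring] at h1
        rw [← h1, show -1 - (l - 1) = -l by ring]
        calc _ ≤ (r * ‖B‖) * ‖geomCoeff A B (-l)‖ := by gcongr
          _ = _ := by ring) (-1 - l)
    simp only [sub_sub_cancel] at key
    refine key.trans ?_
    rw [mul_assoc]
    gcongr
    rw [le_inv_mul_iff₀ hr, ← pow_succ']
    exact pow_le_pow_of_le_one hr.le hr1.le (by omega)

/-! ### Uniform lower bound for the symbol. -/

/-- The symbol of the equation, as a function on the plane. -/
def symbol (a b c ν₁ ν₂ : ℝ) : ℂ :=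
  (1 - a * expChar ν₁) - (b + c * expChar ν₁) * expChar ν₂

/-- On the circle both squared norms are affine in the real part of the character, so their
difference is determined by its values at `1` and `-1`. -/
lemma normSq_sub_normSq (a b c ν : ℝ) : ‖1 - a * expChar ν‖ ^ 2 - ‖b + c * expChar ν‖ ^ 2 =
    (1 + (expChar ν).re) / 2 * ((1 - a - b - c) * (1 - a + b + c)) +
      (1 - (expChar ν).re) / 2 * ((1 + a - b + c) * (1 + a + b - c)) := by
  have h : (expChar ν).re ^ 2 + (expChar ν).im ^ 2 = 1 := by
    have := Complex.sq_norm (expChar ν)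
    rw [norm_expChar, Complex.normSq_apply] at this
    linarith
  rw [Complex.sq_norm, Complex.sq_norm, Complex.normSq_apply, Complex.normSq_apply]
  simp
  linear_combination (a ^ 2 - c ^ 2) * h

lemma abs_re_expChar_le (ν : ℝ) : |(expChar ν).re| ≤ 1 :=
  norm_expChar ν ▸ Complex.abs_re_le_norm _

lemma min_le_convex_combination {P Q x : ℝ} (hx : |x| ≤ 1) :
    min P Q ≤ (1 + x) / 2 * P + (1 - x) / 2 * Q := by
  obtain ⟨h1, h2⟩ := abs_le.1 hx
  have hP := mul_le_mul_of_nonneg_left (min_le_left P Q) (show 0 ≤ (1 + x) / 2 by linarith)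
  have hQ := mul_le_mul_of_nonneg_left (min_le_right P Q) (show 0 ≤ (1 - x) / 2 by linarith)
  linarith

/-- Uniform separation of two norms from a lower bound for the difference of their squares. -/
lemma exists_ratio_and_gap {ι : Type*} {m K : ℝ} (hm : 0 < m) (x y : ι → ℝ)
    (hx : ∀ i, 0 ≤ x i) (hy : ∀ i, 0 ≤ y i) (hK : ∀ i, x i ≤ K)
    (h : ∀ i, m ≤ x i ^ 2 - y i ^ 2) :
    ∃ r d : ℝ, 0 < r ∧ r < 1 ∧ 0 < d ∧ ∀ i, y i ≤ r * x i ∧ d ≤ x i - y i := by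
  rcases isEmpty_or_nonempty ι with hι | ⟨⟨i₀⟩⟩
  · exact ⟨1 / 2, 1, by norm_num, by norm_num, one_pos, fun i => isEmptyElim i⟩
  have hxp : ∀ i, 0 < x i := fun i => by
    by_contra hcon
    have h0 : x i = 0 := le_antisymm (not_lt.1 hcon) (hx i)
    have := h i
    rw [h0] at this
    nlinarith [sq_nonneg (y i)]
  have hK0 : 0 < K := (hxp i₀).trans_le (hK i₀)
  have hyx : ∀ i, y i < x i := fun i => by
    have := h i
    exact lt_of_pow_lt_pow_left₀ 2 (hx i) (by linarith)
  have hd : ∀ i, m / (2 * K) ≤ x i - y i := fun i => by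
    rw [div_le_iff₀ (by positivity)]
    have h1 := h i
    have h2 : x i + y i ≤ 2 * K := by linarith [hK i, hyx i]
    calc m ≤ (x i - y i) * (x i + y i) := by linarith
      _ ≤ _ := by gcongr; linarith [hyx i]
  have hdp : 0 < m / (2 * K) := by positivity
  have hdK : m / (2 * K) ≤ K := by linarith [hd i₀, hy i₀, hK i₀]
  have hq : m / (2 * K) / (2 * K) < 1 := by
    rw [div_lt_one (by positivity)]; linarith
  have hq0 : 0 < m / (2 * K) / (2 * K) := by positivity
  -- The gap `d = m / (2K)` comes from `x² - y² = (x - y)(x + y)`. Since `x ≤ 2K`, it is at least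
  -- `(d / 2K) x`; the factor 2 keeps `r` strictly positive.
  refine ⟨1 - m / (2 * K) / (2 * K), m / (2 * K), by linarith, by linarith, hdp,
    fun i => ⟨?_, hd i⟩⟩
  have : m / (2 * K) / (2 * K) * x i ≤ m / (2 * K) := by
    rw [div_mul_eq_mul_div, div_le_iff₀ (by positivity)]
    gcongr
    linarith [hK i]
  linarith [hd i]

lemma norm_one_sub_le (a ν : ℝ) : ‖1 - a * expChar ν‖ ≤ 1 + |a| :=
  (norm_sub_le _ _).trans (by simp [norm_expChar])

lemma norm_coeff_add_le (b c ν : ℝ) : ‖b + c * expChar ν‖ ≤ |b| + |c| :=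
  (norm_add_le _ _).trans (by simp [norm_expChar])

lemma exists_separation {a b c : ℝ} (hD : 0 < discr a b c) :
    ∃ r d : ℝ, 0 < r ∧ r < 1 ∧ 0 < d ∧ ∀ ν₁ : ℝ,
      (‖b + c * expChar ν₁‖ ≤ r * ‖1 - a * expChar ν₁‖ ∨
        ‖1 - a * expChar ν₁‖ ≤ r * ‖b + c * expChar ν₁‖) ∧
      ∀ ν₂ : ℝ, d ≤ ‖symbol a b c ν₁ ν₂‖ := by
  have hPQ : 0 < ((1 - a - b - c) * (1 - a + b + c)) * ((1 + a - b + c) * (1 + a + b - c)) := by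
    unfold discr at hD; linarith
  have hsplit := normSq_sub_normSq a b c
  generalize (1 - a - b - c) * (1 - a + b + c) = R at *
  generalize (1 + a - b + c) * (1 + a + b - c) = Q at *
  have hmul : ∀ ν₁ ν₂ : ℝ, ‖(b + c * expChar ν₁) * expChar ν₂‖ = ‖b + c * expChar ν₁‖ :=
    fun ν₁ ν₂ => by rw [norm_mul, norm_expChar, mul_one]
  rcases mul_pos_iff.1 hPQ with ⟨hR, hQ⟩ | ⟨hR, hQ⟩
  · obtain ⟨r, d, hr, hr1, hd, h⟩ := exists_ratio_and_gap (lt_min hR hQ)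
      (fun ν : ℝ => ‖1 - a * expChar ν‖) (fun ν : ℝ => ‖b + c * expChar ν‖)
      (fun _ => norm_nonneg _) (fun _ => norm_nonneg _) (norm_one_sub_le a)
      (fun ν => by rw [hsplit]; exact min_le_convex_combination (abs_re_expChar_le ν))
    refine ⟨r, d, hr, hr1, hd, fun ν₁ => ⟨Or.inl (h ν₁).1, fun ν₂ => ?_⟩⟩
    have := norm_sub_norm_le (1 - a * expChar ν₁) ((b + c * expChar ν₁) * expChar ν₂)
    rw [hmul] at this
    exact (h ν₁).2.trans this
  · obtain ⟨r, d, hr, hr1, hd, h⟩ := exists_ratio_and_gap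
      (lt_min (neg_pos.2 hR) (neg_pos.2 hQ))
      (fun ν : ℝ => ‖b + c * expChar ν‖) (fun ν : ℝ => ‖1 - a * expChar ν‖)
      (fun _ => norm_nonneg _) (fun _ => norm_nonneg _) (norm_coeff_add_le b c)
      (fun ν => by
        have h1 := hsplit ν
        have h2 := min_le_convex_combination (P := -R) (Q := -Q) (abs_re_expChar_le ν)
        linarith)
    refine ⟨r, d, hr, hr1, hd, fun ν₁ => ⟨Or.inr (h ν₁).1, fun ν₂ => ?_⟩⟩
    have := norm_sub_norm_le ((b + c * expChar ν₁) * expChar ν₂) (1 - a * expChar ν₁)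
    rw [hmul, norm_sub_rev ((b + c * expChar ν₁) * expChar ν₂)] at this
    exact (h ν₁).2.trans this

lemma symbol_ne_zero {a b c : ℝ} (hD : 0 < discr a b c) (ν₁ ν₂ : ℝ) : symbol a b c ν₁ ν₂ ≠ 0 := by
  obtain ⟨r, d, -, -, hd, h⟩ := exists_separation hD
  exact norm_pos_iff.1 (hd.trans_le ((h ν₁).2 ν₂))

lemma symbol_swap (a b c ν₁ ν₂ : ℝ) : symbol b a c ν₂ ν₁ = symbol a b c ν₁ ν₂ := by
  unfold symbol; ring

lemma discr_swap (a b c : ℝ) : discr b a c = discr a b c := by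
  unfold discr; ring

/-! ### Decay, recurrence and reality of the weights. -/

lemma psiC_eq (a b c : ℝ) (k l : ℤ) : psiC a b c k l =
    ∫ ν₁ in (-1 / 2 : ℝ)..(1 / 2 : ℝ), ∫ ν₂ in (-1 / 2 : ℝ)..(1 / 2 : ℝ),
      expChar ν₁ ^ (-k) * (expChar ν₂ ^ (-l) / symbol a b c ν₁ ν₂) := by
  unfold psiC
  congr! 4 with ν₁ ν₂
  rw [← exp_eq_expChar_zpow, ← exp_eq_expChar_zpow, mul_div_assoc', ← Complex.exp_add]
  congr 1
  · congr 1; push_cast; ring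
  · rw [mul_add, Complex.exp_add]; unfold symbol expChar; ring

lemma psiC_eq_integral_geomCoeff (a b c : ℝ) (k l : ℤ) : psiC a b c k l =
    ∫ ν in (-1 / 2 : ℝ)..(1 / 2 : ℝ),
      expChar ν ^ (-k) * geomCoeff (1 - a * expChar ν) (b + c * expChar ν) l := by
  rw [psiC_eq]
  congr! 2 with ν₁
  rw [intervalIntegral.integral_const_mul]
  rfl

lemma continuous_symbol (a b c : ℝ) : Continuous fun p : ℝ × ℝ => symbol a b c p.1 p.2 := by
  have := continuous_expChar
  unfold symbol
  fun_prop

lemma continuous_integrand {a b c : ℝ} (hD : 0 < discr a b c) (l : ℤ) :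
    Continuous fun p : ℝ × ℝ => expChar p.2 ^ (-l) / symbol a b c p.1 p.2 :=
  ((continuous_expChar_zpow _).comp continuous_snd).div (continuous_symbol a b c)
    fun p => symbol_ne_zero hD p.1 p.2

/-- Fubini; this turns decay in the second index into decay in the first. -/
lemma psiC_swap {a b c : ℝ} (hD : 0 < discr a b c) (k l : ℤ) :
    psiC b a c l k = psiC a b c k l := by
  rw [psiC_eq, psiC_eq, intervalIntegral_intervalIntegral_swap]
  · congr! 4 with ν₁ ν₂
    rw [symbol_swap]; ring
  · have hc : Continuous fun p : ℝ × ℝ =>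
        expChar p.1 ^ (-l) * (expChar p.2 ^ (-k) / symbol b a c p.1 p.2) :=
      ((continuous_expChar_zpow _).comp continuous_fst).mul
        (continuous_integrand (discr_swap a b c ▸ hD) k)
    exact (hc.continuousOn.integrableOn_compact (isCompact_uIcc.prod isCompact_uIcc)).mono_set
      (Set.prod_mono Set.uIoc_subset_uIcc Set.uIoc_subset_uIcc)

lemma continuous_geomCoeff {a b c : ℝ} (hD : 0 < discr a b c) (l : ℤ) :
    Continuous fun ν : ℝ => geomCoeff (1 - a * expChar ν) (b + c * expChar ν) l :=
  intervalIntegral.continuous_parametric_intervalIntegral_of_continuous'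
    (continuous_integrand hD l) _ _

lemma exists_norm_psiC_le {a b c : ℝ} (hD : 0 < discr a b c) :
    ∃ C r : ℝ, 0 ≤ C ∧ 0 < r ∧ r < 1 ∧ ∀ k l : ℤ, ‖psiC a b c k l‖ ≤ C * r ^ l.natAbs := by
  obtain ⟨r, d, hr, hr1, hd, h⟩ := exists_separation hD
  refine ⟨d⁻¹ * r⁻¹, r, by positivity, hr, hr1, fun k l => ?_⟩
  rw [psiC_eq_integral_geomCoeff]
  have := intervalIntegral.norm_integral_le_of_norm_le_const (a := (-1 / 2 : ℝ)) (b := 1 / 2)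
    (C := d⁻¹ * r⁻¹ * r ^ l.natAbs)
    (f := fun ν => expChar ν ^ (-k) * geomCoeff (1 - a * expChar ν) (b + c * expChar ν) l)
    (fun ν _ => by
      rw [norm_mul, norm_zpow, norm_expChar, one_zpow, one_mul]
      exact norm_geomCoeff_le_pow hr hr1 hd (h ν).2 (h ν).1 l)
  refine this.trans_eq ?_
  norm_num

lemma summable_pow_natAbs {r : ℝ} (hr : 0 ≤ r) (hr1 : r < 1) :
    Summable fun k : ℤ => r ^ k.natAbs :=
  .of_nat_of_neg (by simpa using summable_geometric_of_lt_one hr hr1)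
    (by simpa using summable_geometric_of_lt_one hr hr1)

lemma summable_norm_psiC {a b c : ℝ} (hD : 0 < discr a b c) :
    Summable fun kl : ℤ × ℤ => ‖psiC a b c kl.1 kl.2‖ := by
  obtain ⟨C, r, hC, hr, hr1, h⟩ := exists_norm_psiC_le hD
  obtain ⟨C', r', hC', hr', hr1', h'⟩ := exists_norm_psiC_le (discr_swap a b c ▸ hD)
  -- The square root is taken because the decay bounds in `k` and in `l` are multiplied, bounding
  -- the square of the norm.
  set s := √(max r r') with hs
  have hs0 : 0 ≤ s := Real.sqrt_nonneg _
  have hs1 : s < 1 := by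
    rw [hs, Real.sqrt_lt' one_pos, one_pow]; exact max_lt hr1 hr1'
  have hss : s ^ 2 = max r r' := Real.sq_sqrt (hr.le.trans (le_max_left _ _))
  refine Summable.of_nonneg_of_le (fun _ => norm_nonneg _) (fun kl => ?_)
    (((summable_pow_natAbs hs0 hs1).mul_of_nonneg (summable_pow_natAbs hs0 hs1)
      (fun _ => by positivity) (fun _ => by positivity)).mul_left (max C C'))
  have h1 : ‖psiC a b c kl.1 kl.2‖ ≤ max C C' * (s ^ 2) ^ kl.2.natAbs := by
    rw [hss]
    refine (h kl.1 kl.2).trans ?_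
    gcongr <;> exact le_max_left _ _
  have h2 : ‖psiC a b c kl.1 kl.2‖ ≤ max C C' * (s ^ 2) ^ kl.1.natAbs := by
    rw [hss, ← psiC_swap hD]
    refine (h' kl.2 kl.1).trans ?_
    gcongr <;> exact le_max_right _ _
  refine (pow_le_pow_iff_left₀ (norm_nonneg _) (by positivity) two_ne_zero).1 ?_
  calc ‖psiC a b c kl.1 kl.2‖ ^ 2 = ‖psiC a b c kl.1 kl.2‖ * ‖psiC a b c kl.1 kl.2‖ := sq _
    _ ≤ (max C C' * (s ^ 2) ^ kl.1.natAbs) * (max C C' * (s ^ 2) ^ kl.2.natAbs) := by gcongr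
    _ = _ := by ring

/-- The symbol times its reciprocal is `1`; the inner integral reduces to `geomCoeff_recurrence`. -/
lemma psiC_recurrence {a b c : ℝ} (hD : 0 < discr a b c) (k l : ℤ) :
    psiC a b c k l - a * psiC a b c (k - 1) l - b * psiC a b c k (l - 1)
      - c * psiC a b c (k - 1) (l - 1) = if k = 0 ∧ l = 0 then 1 else 0 := by
  have hi : ∀ k l : ℤ, IntervalIntegrable (fun ν : ℝ => expChar ν ^ (-k) *
      geomCoeff (1 - a * expChar ν) (b + c * expChar ν) l) volume (-1 / 2) (1 / 2) := fun k l =>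
    ((continuous_expChar_zpow _).mul (continuous_geomCoeff hD l)).intervalIntegrable _ _
  simp only [psiC_eq_integral_geomCoeff]
  rw [← intervalIntegral.integral_const_mul, ← intervalIntegral.integral_const_mul,
    ← intervalIntegral.integral_const_mul,
    ← intervalIntegral.integral_sub (hi _ _) ((hi _ _).const_mul _),
    ← intervalIntegral.integral_sub ((hi _ _).sub ((hi _ _).const_mul _)) ((hi _ _).const_mul _),
    ← intervalIntegral.integral_sub (((hi _ _).sub ((hi _ _).const_mul _)).sub
      ((hi _ _).const_mul _)) ((hi _ _).const_mul _)]
  trans ∫ ν in (-1 / 2 : ℝ)..(1 / 2 : ℝ), expChar ν ^ (-k) * if l = 0 then 1 else 0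
  · congr! 2 with ν
    rw [← geomCoeff_recurrence (symbol_ne_zero hD ν) l, show -(k - 1) = -k + 1 by ring,
      zpow_add_one₀ (expChar_ne_zero ν)]
    ring
  · rw [intervalIntegral.integral_mul_const, integral_expChar_zpow]
    split_ifs <;> simp_all

lemma conj_expChar (ν : ℝ) : (starRingEnd ℂ) (expChar ν) = expChar (-ν) := by
  unfold expChar
  rw [← Complex.exp_conj]
  simp [Complex.conj_ofNat]

/-- The coefficients are real, so conjugating the integrand amounts to `ν ↦ -ν`, which preserves the
square. -/
lemma conj_psiC (a b c : ℝ) (k l : ℤ) :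
    (starRingEnd ℂ) (psiC a b c k l) = psiC a b c k l := by
  have key : ∀ f : ℝ → ℂ, (starRingEnd ℂ) (∫ ν in (-1 / 2 : ℝ)..(1 / 2 : ℝ), f ν) =
      ∫ ν in (-1 / 2 : ℝ)..(1 / 2 : ℝ), (starRingEnd ℂ) (f (-ν)) := fun f => by
    rw [intervalIntegral.integral_comp_neg (fun ν => (starRingEnd ℂ) (f ν)),
      intervalIntegral.integral_of_le (by norm_num), intervalIntegral.integral_of_le (by norm_num),
      ← integral_conj]
    norm_num
  rw [psiC_eq, key]
  simp_rw [key]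
  congr! 4 with ν₁ ν₂
  simp [symbol, conj_expChar]

lemma psiC_im (a b c : ℝ) (k l : ℤ) : (psiC a b c k l).im = 0 :=
  Complex.conj_eq_iff_im.1 (conj_psiC a b c k l)

lemma ofReal_psi (a b c : ℝ) (k l : ℤ) : (psi a b c k l : ℂ) = psiC a b c k l :=
  Complex.conj_eq_iff_re.1 (conj_psiC a b c k l)

lemma summable_abs_psi {a b c : ℝ} (hD : 0 < discr a b c) :
    Summable fun kl : ℤ × ℤ => |psi a b c kl.1 kl.2| := by
  refine (summable_norm_psiC hD).congr fun kl => ?_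
  rw [← ofReal_psi, Complex.norm_real, Real.norm_eq_abs]

lemma psi_recurrence {a b c : ℝ} (hD : 0 < discr a b c) (k l : ℤ) :
    psi a b c k l - a * psi a b c (k - 1) l - b * psi a b c k (l - 1)
      - c * psi a b c (k - 1) (l - 1) = if k = 0 ∧ l = 0 then 1 else 0 := by
  have := psiC_recurrence hD k l
  simp only [← ofReal_psi] at this
  split_ifs at this ⊢ <;> exact_mod_cast this

/-! ### Inverting the autoregressive operator on bounded families. -/

section Convolution

variable {V : Type*} [NormedAddCommGroup V] [NormedSpace ℝ V]

/-- The first-order planar autoregressive operator. -/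
def arOp (a b c : ℝ) (Y : ℤ × ℤ → V) (p : ℤ × ℤ) : V :=
  Y p - a • Y (p - (1, 0)) - b • Y (p - (0, 1)) - c • Y (p - (1, 1))

/-- The convolution of the weights with a family of vectors. -/
def conv (a b c : ℝ) (Y : ℤ × ℤ → V) (p : ℤ × ℤ) : V :=
  ∑' q : ℤ × ℤ, psi a b c q.1 q.2 • Y (p - q)

variable {a b c : ℝ} {Y : ℤ × ℤ → V} {K : ℝ}

lemma summable_norm_psi_smul (hD : 0 < discr a b c) (hY : ∀ p, ‖Y p‖ ≤ K) (p : ℤ × ℤ) :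
    Summable fun q : ℤ × ℤ => ‖psi a b c q.1 q.2 • Y (p - q)‖ := by
  refine Summable.of_nonneg_of_le (fun _ => norm_nonneg _) (fun q => ?_)
    ((summable_abs_psi hD).mul_right K)
  rw [norm_smul, Real.norm_eq_abs]
  gcongr
  exact hY _

variable [CompleteSpace V]

lemma hasSum_conv (hD : 0 < discr a b c) (hY : ∀ p, ‖Y p‖ ≤ K) (p : ℤ × ℤ) :
    HasSum (fun q : ℤ × ℤ => psi a b c q.1 q.2 • Y (p - q)) (conv a b c Y p) :=
  (summable_norm_psi_smul hD hY p).of_norm.hasSum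

lemma hasSum_conv_sub (hD : 0 < discr a b c) (hY : ∀ p, ‖Y p‖ ≤ K) (p s : ℤ × ℤ) :
    HasSum (fun q : ℤ × ℤ => psi a b c (q - s).1 (q - s).2 • Y (p - q)) (conv a b c Y (p - s)) := by
  have := (Equiv.subRight s).hasSum_iff.2 (hasSum_conv hD hY (p - s))
  refine this.congr_fun fun q => ?_
  simp [sub_sub_sub_cancel_right]

lemma arOp_conv (hD : 0 < discr a b c) (hY : ∀ p, ‖Y p‖ ≤ K) : arOp a b c (conv a b c Y) = Y := by
  ext1 p
  have h := (((hasSum_conv hD hY p).sub ((hasSum_conv_sub hD hY p (1, 0)).const_smul a)).sub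
    ((hasSum_conv_sub hD hY p (0, 1)).const_smul b)).sub
    ((hasSum_conv_sub hD hY p (1, 1)).const_smul c)
  refine h.unique ?_
  convert hasSum_ite_eq (0 : ℤ × ℤ) (Y p) using 2 with q
  have := psi_recurrence hD q.1 q.2
  simp only [smul_smul, ← sub_smul, Prod.fst_sub, Prod.snd_sub, sub_zero, this]
  rcases eq_or_ne q 0 with rfl | hq
  · simp
  · rw [if_neg hq, if_neg (fun h => hq (Prod.ext h.1 h.2)), zero_smul]

lemma conv_arOp (hD : 0 < discr a b c) (hY : ∀ p, ‖Y p‖ ≤ K) :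
    conv a b c (arOp a b c Y) = Y := by
  -- It remains to see that `conv` and `arOp` commute, which holds termwise in the series.
  conv_rhs => rw [← arOp_conv hD hY]
  ext1 p
  have hs : ∀ s p, HasSum (fun q : ℤ × ℤ => psi a b c q.1 q.2 • Y (p - q - s))
      (conv a b c Y (p - s)) := fun s p => by
    simpa only [sub_right_comm] using hasSum_conv hD hY (p - s)
  have h := (((hasSum_conv hD hY p).sub ((hs (1, 0) p).const_smul a)).sub
    ((hs (0, 1) p).const_smul b)).sub ((hs (1, 1) p).const_smul c)
  refine (h.congr_fun fun q => ?_).tsum_eq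
  simp only [arOp, smul_sub, smul_comm (psi a b c q.1 q.2)]

end Convolution

/-! ### Translation to square-integrable random variables. -/

section Probability

variable {Ω : Type*} [MeasurableSpace Ω] {P : Measure Ω}

lemma inner_toLp {X Y : Ω → ℝ} (hX : MemLp X 2 P) (hY : MemLp Y 2 P) :
    inner ℝ (hX.toLp X) (hY.toLp Y) = ∫ ω, X ω * Y ω ∂P := by
  rw [L2.inner_def]
  refine integral_congr_ae ?_
  filter_upwards [hX.coeFn_toLp, hY.coeFn_toLp] with ω h1 h2
  rw [h1, h2]
  simp [mul_comm]

variable {σsq a b c : ℝ} {ε : ℤ × ℤ → Ω → ℝ}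

/-- White noise as a family of vectors of the Hilbert space of square-integrable variables. -/
def IsWhiteNoise.vec (hε : IsWhiteNoise P σsq ε) (p : ℤ × ℤ) : Lp ℝ 2 P :=
  (hε.memLp p).toLp (ε p)

lemma IsWhiteNoise.memLp_seriesTerm (hε : IsWhiteNoise P σsq ε) (i j : ℤ) (kl : ℤ × ℤ) :
    MemLp (seriesTerm a b c ε i j kl) 2 P :=
  (hε.memLp _).const_mul _

lemma IsWhiteNoise.memLp_sum_seriesTerm (hε : IsWhiteNoise P σsq ε) (i j : ℤ)
    (s : Finset (ℤ × ℤ)) : MemLp (fun ω => ∑ kl ∈ s, seriesTerm a b c ε i j kl ω) 2 P :=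
  memLp_finsetSum s fun kl _ => hε.memLp_seriesTerm i j kl

lemma IsWhiteNoise.toLp_sum_seriesTerm (hε : IsWhiteNoise P σsq ε) (i j : ℤ)
    (s : Finset (ℤ × ℤ)) :
    (hε.memLp_sum_seriesTerm (a := a) (b := b) (c := c) i j s).toLp _ =
      ∑ kl ∈ s, psi a b c kl.1 kl.2 • hε.vec ((i, j) - kl) := by
  classical
  induction s using Finset.induction_on with
  | empty =>
    simp only [Finset.sum_empty]
    exact MemLp.toLp_zero _
  | insert kl s h ih =>
    rw [Finset.sum_insert h, ← ih, IsWhiteNoise.vec, ← MemLp.toLp_const_smul, ← MemLp.toLp_add]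
    congr 1
    ext ω
    rw [Finset.sum_insert h]
    rfl

/-- For square-integrable fields the autoregressive equation is an identity in `L²`. -/
lemma IsWhiteNoise.satisfiesEquation_iff (hε : IsWhiteNoise P σsq ε) {X : ℤ × ℤ → Ω → ℝ}
    (hX : ∀ p, MemLp (X p) 2 P) : SatisfiesEquation P a b c ε X ↔
      arOp a b c (fun p => (hX p).toLp (X p)) = hε.vec := by
  have key : ∀ p, arOp a b c (fun p => (hX p).toLp (X p)) p = hε.vec p ↔
      ∀ᵐ ω ∂P, X p ω = a * X (p - (1, 0)) ω + b * X (p - (0, 1)) ω + c * X (p - (1, 1)) ω + ε p ω := by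
    intro p
    rw [arOp, IsWhiteNoise.vec, ← MemLp.toLp_const_smul, ← MemLp.toLp_const_smul,
      ← MemLp.toLp_const_smul, ← MemLp.toLp_sub, ← MemLp.toLp_sub, ← MemLp.toLp_sub,
      MemLp.toLp_eq_toLp_iff]
    refine eventually_congr (.of_forall fun ω => ?_)
    simp only [Pi.sub_apply, Pi.smul_apply, smul_eq_mul]
    constructor <;> intro h <;> linarith
  rw [funext_iff, Prod.forall]
  refine forall_congr' fun i => forall_congr' fun j => ?_
  rw [key]
  simp

variable [IsProbabilityMeasure P]

lemma covariance_eq_inner {X Y : Ω → ℝ} (hX : MemLp X 2 P) (hY : MemLp Y 2 P) :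
    covariance X Y P = inner ℝ (hX.toLp X) (hY.toLp Y) - (∫ ω, X ω ∂P) * ∫ ω, Y ω ∂P := by
  rw [covariance_eq_sub hX hY, inner_toLp]
  rfl

/-- Makes expectation a continuous functional on `L²`, so that it passes through the series. -/
lemma integral_eq_inner_one {X : Ω → ℝ} (hX : MemLp X 2 P) :
    ∫ ω, X ω ∂P = inner ℝ (hX.toLp X) ((memLp_const (1 : ℝ) : MemLp (fun _ : Ω => (1 : ℝ)) 2 P).toLp _) := by
  rw [inner_toLp]
  simp

lemma IsWideSenseStationary.exists_norm_le {X : ℤ × ℤ → Ω → ℝ}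
    (hX : IsWideSenseStationary P X) : ∃ K, ∀ p, ‖(hX.memLp p).toLp (X p)‖ ≤ K := by
  refine ⟨‖(hX.memLp 0).toLp (X 0)‖, fun p => le_of_eq ?_⟩
  have h := hX.covariance_shift 0 0 p
  rw [zero_add, covariance_eq_inner (hX.memLp p) (hX.memLp p),
    covariance_eq_inner (hX.memLp 0) (hX.memLp 0), hX.mean_eq p 0, sub_left_inj,
    real_inner_self_eq_norm_sq, real_inner_self_eq_norm_sq] at h
  exact (pow_left_inj₀ (norm_nonneg _) (norm_nonneg _) two_ne_zero).1 h

lemma IsWhiteNoise.inner_vec (hε : IsWhiteNoise P σsq ε) (p q : ℤ × ℤ) :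
    inner ℝ (hε.vec p) (hε.vec q) = if p = q then σsq else 0 := by
  have h := covariance_eq_inner (hε.memLp p) (hε.memLp q)
  rw [hε.mean_zero, zero_mul, sub_zero] at h
  rw [vec, vec, ← h]
  split_ifs with hpq
  · rw [hpq, covariance_self (hε.memLp q).aemeasurable, hε.variance_eq]
  · exact hε.uncorrelated p q hpq

lemma IsWhiteNoise.norm_vec (hε : IsWhiteNoise P σsq ε) (p : ℤ × ℤ) : ‖hε.vec p‖ = √σsq := by
  rw [norm_eq_sqrt_real_inner, hε.inner_vec, if_pos rfl]

/-- The sum of absolute values has finite expectation, by Tonelli and `L¹ ≤ L²` on a probability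
space. -/
lemma IsWhiteNoise.ae_summable_seriesTerm (hε : IsWhiteNoise P σsq ε) (hD : 0 < discr a b c)
    (i j : ℤ) : ∀ᵐ ω ∂P, Summable fun kl : ℤ × ℤ => |seriesTerm a b c ε i j kl ω| := by
  have hmeas : ∀ kl : ℤ × ℤ, AEMeasurable (fun ω => ‖seriesTerm a b c ε i j kl ω‖ₑ) P := fun kl =>
    ((hε.memLp _).aemeasurable.const_mul _).enorm
  have hle : ∀ kl : ℤ × ℤ, ∫⁻ ω, ‖seriesTerm a b c ε i j kl ω‖ₑ ∂P ≤
      ENNReal.ofReal (|psi a b c kl.1 kl.2| * √σsq) := fun kl => by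
    calc ∫⁻ ω, ‖seriesTerm a b c ε i j kl ω‖ₑ ∂P
        = ENNReal.ofReal |psi a b c kl.1 kl.2| * eLpNorm (ε (i - kl.1, j - kl.2)) 1 P := by
          simp only [seriesTerm, enorm_mul]
          rw [lintegral_const_mul'' _ (hε.memLp _).aemeasurable.enorm, eLpNorm_one_eq_lintegral_enorm,
            Real.enorm_eq_ofReal_abs]
      _ ≤ ENNReal.ofReal |psi a b c kl.1 kl.2| * eLpNorm (ε (i - kl.1, j - kl.2)) 2 P := by
          gcongr
          exact eLpNorm_le_eLpNorm_of_exponent_le one_le_two (hε.memLp _).aestronglyMeasurable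
      _ = _ := by
          rw [ENNReal.ofReal_mul (abs_nonneg _), ← hε.norm_vec (i - kl.1, j - kl.2), vec,
            Lp.norm_toLp, ENNReal.ofReal_toReal (hε.memLp _).eLpNorm_ne_top]
  have hfin : ∫⁻ ω, ∑' kl, ‖seriesTerm a b c ε i j kl ω‖ₑ ∂P ≠ ⊤ := by
    rw [lintegral_tsum hmeas]
    exact ne_top_of_le_ne_top ((summable_abs_psi hD).mul_right _).tsum_ofReal_ne_top
      (ENNReal.tsum_le_tsum hle)
  filter_upwards [ae_lt_top' (AEMeasurable.tsum hmeas) hfin] with ω hω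
  have := ENNReal.summable_toReal hω.ne
  simpa using this

lemma IsWhiteNoise.tendsto_eLpNorm_conv (hε : IsWhiteNoise P σsq ε) (hD : 0 < discr a b c)
    (i j : ℤ) : Tendsto (fun s : Finset (ℤ × ℤ) =>
      eLpNorm ((fun ω => ∑ kl ∈ s, seriesTerm a b c ε i j kl ω) - ⇑(conv a b c hε.vec (i, j))) 2 P)
      atTop (𝓝 0) := by
  rw [← Lp.tendsto_Lp_iff_tendsto_eLpNorm'' _ (hε.memLp_sum_seriesTerm i j) _
    (Lp.memLp (conv a b c hε.vec (i, j))), Lp.toLp_coeFn]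
  simp only [hε.toLp_sum_seriesTerm]
  exact hasSum_conv hD (fun p => (hε.norm_vec p).le) (i, j)

/-- Mean-square convergence yields almost sure convergence along a sequence of finite sets tending
to `atTop`; there the absolutely convergent series has the same limit. -/
lemma IsWhiteNoise.conv_ae_eq_seriesField (hε : IsWhiteNoise P σsq ε) (hD : 0 < discr a b c)
    (p : ℤ × ℤ) : ⇑(conv a b c hε.vec p) =ᵐ[P] seriesField a b c ε p := by
  have hm := tendstoInMeasure_of_tendsto_eLpNorm two_ne_zero
    (fun s => (hε.memLp_sum_seriesTerm p.1 p.2 s).aestronglyMeasurable)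
    (Lp.aestronglyMeasurable _) (hε.tendsto_eLpNorm_conv hD p.1 p.2)
  obtain ⟨s, hs, hlim⟩ := hm.exists_seq_tendsto_ae'
  filter_upwards [hlim, hε.ae_summable_seriesTerm hD p.1 p.2] with ω h1 h2
  exact tendsto_nhds_unique h1 (h2.of_abs.hasSum.comp hs)

lemma IsWhiteNoise.memLp_seriesField (hε : IsWhiteNoise P σsq ε) (hD : 0 < discr a b c)
    (p : ℤ × ℤ) : MemLp (seriesField a b c ε p) 2 P :=
  (memLp_congr_ae (hε.conv_ae_eq_seriesField hD p)).1 (Lp.memLp _)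

lemma IsWhiteNoise.toLp_seriesField (hε : IsWhiteNoise P σsq ε) (hD : 0 < discr a b c)
    (p : ℤ × ℤ) : (hε.memLp_seriesField hD p).toLp _ = conv a b c hε.vec p := by
  rw [← Lp.toLp_coeFn (conv a b c hε.vec p) (Lp.memLp _), MemLp.toLp_eq_toLp_iff]
  exact (hε.conv_ae_eq_seriesField hD p).symm

lemma IsWhiteNoise.integral_seriesField (hε : IsWhiteNoise P σsq ε) (hD : 0 < discr a b c)
    (p : ℤ × ℤ) : ∫ ω, seriesField a b c ε p ω ∂P = 0 := by
  rw [integral_eq_inner_one (hε.memLp_seriesField hD p), hε.toLp_seriesField hD, real_inner_comm]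
  refine ((innerSL ℝ _).hasSum (hasSum_conv hD (fun p => (hε.norm_vec p).le) p)).unique ?_
  convert hasSum_zero using 2 with q
  rw [innerSL_apply_apply, inner_smul_right, real_inner_comm, vec, ← integral_eq_inner_one,
    hε.mean_zero, mul_zero]

/-- The right side depends on `p` and `q` only through `p - s = q - t`, hence is invariant under a
joint shift. -/
lemma IsWhiteNoise.inner_conv (hε : IsWhiteNoise P σsq ε) (hD : 0 < discr a b c) (p q : ℤ × ℤ) :
    inner ℝ (conv a b c hε.vec p) (conv a b c hε.vec q) =
      ∑' s : ℤ × ℤ, ∑' t : ℤ × ℤ, psi a b c s.1 s.2 * (psi a b c t.1 t.2 *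
        if p - s = q - t then σsq else 0) := by
  have hb : ∀ p, ‖hε.vec p‖ ≤ √σsq := fun p => (hε.norm_vec p).le
  rw [real_inner_comm]
  refine (((innerSL ℝ _).hasSum (hasSum_conv hD hb p)).tsum_eq.symm.trans ?_)
  refine tsum_congr fun s => ?_
  rw [innerSL_apply_apply, inner_smul_right, real_inner_comm, tsum_mul_left]
  congr 1
  refine (((innerSL ℝ _).hasSum (hasSum_conv hD hb q)).tsum_eq.symm.trans ?_)
  refine tsum_congr fun t => ?_
  rw [innerSL_apply_apply, inner_smul_right, hε.inner_vec]

lemma IsWhiteNoise.isWideSenseStationary_seriesField (hε : IsWhiteNoise P σsq ε)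
    (hD : 0 < discr a b c) : IsWideSenseStationary P (seriesField a b c ε) where
  memLp := hε.memLp_seriesField hD
  mean_eq p q := by rw [hε.integral_seriesField hD, hε.integral_seriesField hD]
  covariance_shift p q h := by
    have hm := hε.memLp_seriesField hD
    rw [covariance_eq_inner (hm _) (hm _), covariance_eq_inner (hm _) (hm _)]
    simp only [hε.toLp_seriesField hD, hε.integral_seriesField hD, hε.inner_conv hD,
      add_sub_right_comm _ h, add_left_inj]

end Probability

end PlanarAR

end

theorem mainTheorem3 {Ω : Type*} [MeasurableSpace Ω] (P : Measure Ω) [IsProbabilityMeasure P]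
    (σsq a b c : ℝ) (hσ : 0 < σsq) (ε : ℤ × ℤ → Ω → ℝ)
    (hε : PlanarAR.IsWhiteNoise P σsq ε) (hD : 0 < PlanarAR.discr a b c) :
    -- the weights are real and absolutely summable
    (∀ k l : ℤ, (PlanarAR.psiC a b c k l).im = 0) ∧
    Summable (fun kl : ℤ × ℤ => |PlanarAR.psi a b c kl.1 kl.2|) ∧
    -- the double series converges absolutely almost surely
    (∀ i j : ℤ, ∀ᵐ ω ∂P,
      Summable (fun kl : ℤ × ℤ => |PlanarAR.seriesTerm a b c ε i j kl ω|)) ∧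
    -- it converges in mean square, unconditionally and to the same limit
    (∀ i j : ℤ, Tendsto
      (fun s : Finset (ℤ × ℤ) =>
        eLpNorm (fun ω => (∑ kl ∈ s, PlanarAR.seriesTerm a b c ε i j kl ω)
          - PlanarAR.seriesField a b c ε (i, j) ω) 2 P)
      atTop (𝓝 0)) ∧
    -- its sum is a stationary solution
    PlanarAR.IsStationarySolution P a b c ε (PlanarAR.seriesField a b c ε) ∧
    -- every stationary solution coincides with it almost surely
    (∀ X : ℤ × ℤ → Ω → ℝ, PlanarAR.IsStationarySolution P a b c ε X →
      ∀ p : ℤ × ℤ, X p =ᵐ[P] PlanarAR.seriesField a b c ε p) := by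
  refine ⟨PlanarAR.psiC_im a b c, PlanarAR.summable_abs_psi hD, hε.ae_summable_seriesTerm hD,
    fun i j => ?_, ⟨hε.isWideSenseStationary_seriesField hD, ?_⟩, fun X hX p => ?_⟩
  · refine (hε.tendsto_eLpNorm_conv hD i j).congr fun s => eLpNorm_congr_ae ?_
    filter_upwards [hε.conv_ae_eq_seriesField hD (i, j)] with ω hω
    rw [Pi.sub_apply, hω]
  · rw [hε.satisfiesEquation_iff (hε.memLp_seriesField hD)]
    simp only [hε.toLp_seriesField hD]
    exact PlanarAR.arOp_conv hD fun p => (hε.norm_vec p).le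
  -- Stationarity enters only through the uniform `L²` bound that `conv_arOp` needs.
  · obtain ⟨K, hK⟩ := hX.1.exists_norm_le
    have h := PlanarAR.conv_arOp hD hK
    rw [(hε.satisfiesEquation_iff hX.1.memLp).1 hX.2] at h
    rw [← MemLp.toLp_eq_toLp_iff (hX.1.memLp p) (hε.memLp_seriesField hD p),
      hε.toLp_seriesField hD, h]
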